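/- For integers $1 \le a \le b \le c$ with $b \ge 2$, let the theta graph $\Theta(a,b,c)$ be the simple graph with $a+b+c-1$ vertices and $a+b+c$ edges that consists of three internally disjoint paths of lengths $a$, $b$ and $c$ with common end points. For a simple graph $G$ and an integer $n \ge 0$, a $G$ design of order $n$ is a partition of the edge set of the complete graph $K_n$ into edge sets of subgraphs each isomorphic to $G$ (for $n = 0$ and $n = 1$ the empty collection is a $G$ design of order $n$). **Theorem.** Let $1 \le a \le b \le c$ be integers with $b \ge 2$ and $a+b+c = 13$, and let $n \ge 0$ be an integer. Then a $\Theta(a,b,c)$ design of order $n$ exists if and only if $n \equiv 0$ or $1 \pmod{13}$. -/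

import Mathlib

/-- The label of the `k`-th vertex (`0 ≤ k ≤ l`) on a path of length `l` from the vertex `0` to the
vertex `1` whose inner vertices carry the consecutive labels `s + 1, …, s + (l - 1)`. -/
def thetaPathVertex (s l k : ℕ) : ℕ :=
  if k = 0 then 0 else if k = l then 1 else s + k

/-- The theta graph `Θ(a,b,c)`, for `1 ≤ a ≤ b ≤ c` and `2 ≤ b`: the graph on `a + b + c - 1`
vertices `0, 1, …, a + b + c - 2` that consists of three paths of lengths `a`, `b` and `c`, with
common end points `0` and `1`. Their inner vertices are `2, …, a`, then `a + 1, …, a + b - 1`,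
then `a + b, …, a + b + c - 2`. -/
def thetaGraph (a b c : ℕ) : SimpleGraph (Fin (a + b + c - 1)) :=
  SimpleGraph.fromRel fun u v =>
    (∃ k < a, (u : ℕ) = thetaPathVertex 1 a k ∧ (v : ℕ) = thetaPathVertex 1 a (k + 1)) ∨
    (∃ k < b, (u : ℕ) = thetaPathVertex a b k ∧ (v : ℕ) = thetaPathVertex a b (k + 1)) ∨
    (∃ k < c, (u : ℕ) = thetaPathVertex (a + b - 1) c k ∧
      (v : ℕ) = thetaPathVertex (a + b - 1) c (k + 1))

/-- There is a decomposition of `K` into `G`: a set of subgraphs of `K`, each isomorphic to `G`,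
such that every edge of `K` is an edge of exactly one of them. -/
def HasDecomposition {V W : Type*} (K : SimpleGraph V) (G : SimpleGraph W) : Prop :=
  ∃ D : Set K.Subgraph,
    (∀ H ∈ D, Nonempty (G ≃g H.coe)) ∧
    ∀ e ∈ K.edgeSet, ∃! H, H ∈ D ∧ e ∈ H.edgeSet

/-- There is a `G` design of order `n`: a decomposition of the complete graph `K_n` into `G`. -/
def HasDesign {W : Type*} (G : SimpleGraph W) (n : ℕ) : Prop :=
  HasDecomposition (⊤ : SimpleGraph (Fin n)) G

/-! Necessity is a count: the theta graph has 13 edges, so 13 divides n(n-1)/2, and since 13 is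
prime, n is 0 or 1 mod 13.

For sufficiency write n = 13t + f with f = 0 or 1 and induct on t. Wilson's construction starts from
a group divisible design on t points with blocks of sizes 3, 4 and 5. Every point is replaced by 13
copies and, if f = 1, one common point is added. Pairs over different groups lie over exactly one
block, where the equipartite graph with parts of size 13 is decomposed; each group, together with
the added point, carries a smaller design (`IsDecomposable.complete_of_gdd`). So beyond t = 0 it is
enough to have the orders 13, 14, 26, 27, the three equipartite graphs with 3, 4 and 5 parts, and a
group divisible design with at least two groups for every t ≥ 3.

The ingredients (`HasIngredients`) come from base blocks developed by a cyclic group, checked by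
kernel evaluation for each of the 13 theta graphs. The group divisible designs are truncated
transversal designs for t = 3m + h with m odd and h ≤ m (`HasIngredients.complete_of_odd`); the
values 5, 6, 7, 8, 13, 14 that have no such form get small explicit designs. -/

/-! ### Decompositions presented by injections -/

/-- The pair `x, y` is the image under `f` of an edge of `G`. -/
def Covers {V W : Type} (G : SimpleGraph W) (f : W → V) (x y : V) : Prop :=
  ∃ u v, G.Adj u v ∧ f u = x ∧ f v = y

/-- A decomposition of `K` into `G`, presented by a set of injections of the vertices of `G`. -/
def IsDecomposable {V W : Type} (K : SimpleGraph V) (G : SimpleGraph W) : Prop :=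
  ∃ D : Set (W → V),
    (∀ f ∈ D, Function.Injective f ∧ ∀ x y, Covers G f x y → K.Adj x y) ∧
    ∀ x y, K.Adj x y → ∃! f, f ∈ D ∧ Covers G f x y

/-- The subgraph of `K` that is the image of `G` under `f`. -/
def imageSubgraph {V W : Type} (K : SimpleGraph V) (G : SimpleGraph W) (f : W → V)
    (hf : ∀ x y, Covers G f x y → K.Adj x y) : K.Subgraph where
  verts := Set.range f
  Adj := Covers G f
  adj_sub := hf _ _
  edge_vert := by
    rintro _ _ ⟨u, v, -, rfl, rfl⟩
    exact ⟨u, rfl⟩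
  symm := ⟨by
    rintro _ _ ⟨u, v, h, rfl, rfl⟩
    exact ⟨v, u, h.symm, rfl, rfl⟩⟩

theorem covers_apply_iff {V W : Type} {G : SimpleGraph W} {f : W → V} (hf : Function.Injective f)
    (u v : W) : Covers G f (f u) (f v) ↔ G.Adj u v := by
  constructor
  · rintro ⟨u', v', h, hu, hv⟩
    rwa [← hf hu, ← hf hv]
  · exact fun h => ⟨u, v, h, rfl, rfl⟩

theorem IsDecomposable.hasDecomposition {V W : Type} {K : SimpleGraph V} {G : SimpleGraph W}
    (h : IsDecomposable K G) : HasDecomposition K G := by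
  obtain ⟨D, hD, hK⟩ := h
  refine ⟨{H | ∃ f, ∃ hf : f ∈ D, H = imageSubgraph K G f (hD f hf).2}, ?_, ?_⟩
  · rintro _ ⟨f, hf, rfl⟩
    exact ⟨⟨Equiv.ofInjective f (hD f hf).1, covers_apply_iff (hD f hf).1 _ _⟩⟩
  · intro e
    induction e with
    | _ x y =>
      intro he
      obtain ⟨f, ⟨hf, hc⟩, hu⟩ := hK x y he
      refine ⟨_, ⟨⟨f, hf, rfl⟩, hc⟩, ?_⟩
      rintro _ ⟨⟨f', hf', rfl⟩, hc'⟩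
      have : f' = f := hu f' ⟨hf', hc'⟩
      subst this
      rfl

theorem IsDecomposable.map {V V' W : Type} {K : SimpleGraph V} {G : SimpleGraph W}
    (h : IsDecomposable K G) (φ : V ↪ V') : IsDecomposable (K.map φ) G := by
  obtain ⟨D, hD, hK⟩ := h
  have hφ : ∀ f x y, Covers G (φ ∘ f) (φ x) (φ y) ↔ Covers G f x y := by
    intro f x y
    simp [Covers]
  refine ⟨(φ ∘ ·) '' D, ?_, ?_⟩
  · rintro _ ⟨f, hf, rfl⟩
    refine ⟨φ.injective.comp (hD f hf).1, ?_⟩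
    rintro _ _ ⟨u, v, huv, rfl, rfl⟩
    exact (SimpleGraph.map_adj_apply).2 ((hD f hf).2 _ _ ⟨u, v, huv, rfl, rfl⟩)
  · intro _ _ h
    obtain ⟨x, y, hxy, rfl, rfl⟩ := (SimpleGraph.map_adj _ _ _ _).1 h
    obtain ⟨f, ⟨hf, hc⟩, hu⟩ := hK x y hxy
    refine ⟨φ ∘ f, ⟨⟨f, hf, rfl⟩, (hφ f x y).2 hc⟩, ?_⟩
    rintro _ ⟨⟨f', hf', rfl⟩, hc'⟩
    have : f' = f := hu f' ⟨hf', (hφ f' x y).1 hc'⟩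
    subst this
    rfl

theorem IsDecomposable.of_iso {V V' W : Type} {K : SimpleGraph V} {K' : SimpleGraph V'}
    {G : SimpleGraph W} (h : IsDecomposable K G) (e : K ≃g K') : IsDecomposable K' G := by
  have h' := h.map e.toEquiv.toEmbedding
  convert h'
  ext x y
  rw [SimpleGraph.map_adj]
  constructor
  · exact fun hxy => ⟨e.symm x, e.symm y, e.symm.map_adj_iff.2 hxy, by simp, by simp⟩
  · rintro ⟨u, v, huv, rfl, rfl⟩
    exact e.map_adj_iff.2 huv

theorem IsDecomposable.union {V W ι : Type} {K : SimpleGraph V} {G : SimpleGraph W}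
    {L : ι → SimpleGraph V} (hL : ∀ i, L i ≤ K) (hK : ∀ x y, K.Adj x y → ∃! i, (L i).Adj x y)
    (h : ∀ i, IsDecomposable (L i) G) : IsDecomposable K G := by
  choose D hD hLD using h
  refine ⟨⋃ i, D i, ?_, ?_⟩
  · intro f hf
    obtain ⟨i, hf⟩ := Set.mem_iUnion.1 hf
    exact ⟨(hD i f hf).1, fun x y hc => hL i ((hD i f hf).2 x y hc)⟩
  · intro x y hxy
    obtain ⟨i, hi, hiu⟩ := hK x y hxy
    obtain ⟨f, ⟨hf, hc⟩, hu⟩ := hLD i x y hi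
    refine ⟨f, ⟨Set.mem_iUnion.2 ⟨i, hf⟩, hc⟩, ?_⟩
    rintro f' ⟨hf', hc'⟩
    obtain ⟨j, hf'⟩ := Set.mem_iUnion.1 hf'
    obtain rfl : j = i := hiu j ((hD j f' hf').2 x y hc')
    exact hu f' ⟨hf', hc'⟩

/-! ### The method of differences -/

/-- The method of differences: the translates of base blocks form a decomposition if every
difference occurs exactly once in the base blocks. -/
theorem IsDecomposable.of_translates {V W ι A Δ : Type} {K : SimpleGraph V} {G : SimpleGraph W}
    (t : A → V → V) (d : V → V → Δ) (ht : ∀ g, Function.Injective (t g))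
    (hK : ∀ g x y, K.Adj x y → K.Adj (t g x) (t g y))
    (hd : ∀ g x y, d (t g x) (t g y) = d x y)
    (hfree : ∀ x y x' y', K.Adj x y → K.Adj x' y' → d x y = d x' y' →
      ∃! g, t g x = x' ∧ t g y = y')
    (B : ι → W → V) (hB : ∀ i, Function.Injective (B i))
    (hadj : ∀ i u v, G.Adj u v → K.Adj (B i u) (B i v))
    (hcov : ∀ x y, K.Adj x y → ∃ i u v, G.Adj u v ∧ d (B i u) (B i v) = d x y)
    (hinj : ∀ i u v i' u' v', G.Adj u v → G.Adj u' v' →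
      d (B i u) (B i v) = d (B i' u') (B i' v') → i = i' ∧ u = u' ∧ v = v') :
    IsDecomposable K G := by
  refine ⟨{f | ∃ g i, f = t g ∘ B i}, ?_, ?_⟩
  · rintro _ ⟨g, i, rfl⟩
    refine ⟨(ht g).comp (hB i), ?_⟩
    rintro _ _ ⟨u, v, huv, rfl, rfl⟩
    exact hK _ _ _ (hadj i u v huv)
  · intro x y hxy
    obtain ⟨i, u, v, huv, he⟩ := hcov x y hxy
    -- A base arc with the difference of `(x, y)` has exactly one translate equal to `(x, y)`;
    -- uniqueness of the base arc then gives uniqueness of the block.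
    obtain ⟨g, ⟨hx, hy⟩, hg⟩ := hfree _ _ _ _ (hadj i u v huv) hxy he
    refine ⟨t g ∘ B i, ⟨⟨g, i, rfl⟩, u, v, huv, hx, hy⟩, ?_⟩
    rintro _ ⟨⟨g', i', rfl⟩, u', v', huv', hx', hy'⟩
    simp only [Function.comp_apply] at hx' hy'
    obtain ⟨rfl, rfl, rfl⟩ := hinj i u v i' u' v' huv huv' (by rw [he, ← hx', ← hy', hd])
    rw [hg g' ⟨hx', hy'⟩]

/-! ### Computable forms of theta graphs, orbits and differences -/

/-- The edges of `thetaGraph a b c`, path by path. -/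
def thetaEdges (a b c : ℕ) : List (ℕ × ℕ) :=
  (List.range a).map (fun k => (thetaPathVertex 1 a k, thetaPathVertex 1 a (k + 1))) ++
  (List.range b).map (fun k => (thetaPathVertex a b k, thetaPathVertex a b (k + 1))) ++
  (List.range c).map
    (fun k => (thetaPathVertex (a + b - 1) c k, thetaPathVertex (a + b - 1) c (k + 1)))

/-- The edges of `thetaGraph a b c` in both directions. -/
def thetaArcs (a b c : ℕ) : List (ℕ × ℕ) :=
  thetaEdges a b c ++ (thetaEdges a b c).map Prod.swap

theorem thetaGraph_adj {a b c : ℕ} (u v : Fin (a + b + c - 1)) :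
    (thetaGraph a b c).Adj u v ↔ u ≠ v ∧ ((u : ℕ), (v : ℕ)) ∈ thetaArcs a b c := by
  have h : ∀ x y, (x, y) ∈ thetaArcs a b c ↔
      (x, y) ∈ thetaEdges a b c ∨ (y, x) ∈ thetaEdges a b c := by
    simp [thetaArcs]
  simp only [h, thetaGraph, SimpleGraph.fromRel_adj, thetaEdges, List.mem_append,
    List.mem_map, List.mem_range, Prod.mk.injEq, or_assoc, @eq_comm ℕ (u : ℕ), @eq_comm ℕ (v : ℕ)]

/-- The vertices on which the translations by `Fin m` act: `r` full orbits and a set `F` of fixed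
points. -/
abbrev OrbitVertex (m r : ℕ) (F : Type) : Type := Fin m × Fin r ⊕ F

/-- The orbit of a vertex (`none` for a fixed point). -/
def orbitLevel {m r : ℕ} {F : Type} : OrbitVertex m r F → Option (Fin r)
  | .inl p => some p.2
  | .inr _ => none

/-- Translation by `g`. -/
def orbitShift {m r : ℕ} {F : Type} (g : Fin m) : OrbitVertex m r F → OrbitVertex m r F
  | .inl p => .inl (p.1 + g, p.2)
  | .inr s => .inr s

/-- A number that determines the difference of two vertices and their orbits. -/
def orbitCode {m r : ℕ} [NeZero m] {F : Type} : OrbitVertex m r F → OrbitVertex m r F → ℕ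
  -- The difference is taken modulo `m`, but the `+ 1` on orbit numbers is in `ℕ`, so that 0 is left
  -- to mark a fixed point.
  | .inl p, .inl q => Nat.pair (q.1 - p.1 : Fin m) (Nat.pair (p.2 + 1) (q.2 + 1))
  | .inl p, .inr _ => Nat.pair 0 (Nat.pair (p.2 + 1) 0)
  | .inr _, .inl q => Nat.pair 0 (Nat.pair 0 (q.2 + 1))
  | .inr _, .inr _ => Nat.pair 0 (Nat.pair 0 0)

/-- The vertex at position `u` of the `i`-th base block. -/
def blockVertex {V : Type} (f : ℕ → V) (B : List (List ℕ)) (i u : ℕ) : V :=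
  f ((B.getD i []).getD u 0)

/-- The arcs of the base blocks: the number of a block and an arc of the theta graph. -/
def blockArcs (a b c : ℕ) (B : List (List ℕ)) : List (ℕ × ℕ × ℕ) :=
  List.range B.length ×ˢ thetaArcs a b c

/-- The difference on an arc of a base block. -/
def arcDiff {m r : ℕ} [NeZero m] {F : Type} (f : ℕ → OrbitVertex m r F) (B : List (List ℕ))
    (l : ℕ × ℕ × ℕ) : ℕ :=
  orbitCode (blockVertex f B l.1 l.2.1) (blockVertex f B l.1 l.2.2)

/-! ### Finite check of base blocks, with sets of differences stored as bits of one number -/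

/-- The binary mask of a list of numbers. -/
def bitMask (l : List ℕ) : ℕ :=
  l.foldr (fun c a => a ||| 1 <<< c) 0

/-- Whether a list of numbers has no repetitions and avoids the bits of `acc`. -/
def distinctBits : List ℕ → ℕ → Bool
  | [], _ => true
  | c :: l, acc => !acc.testBit c && distinctBits l (acc ||| 1 <<< c)

theorem mem_of_testBit_bitMask {l : List ℕ} {c : ℕ} (h : (bitMask l).testBit c = true) :
    c ∈ l := by
  induction l with
  | nil => simp [bitMask] at h
  | cons d l ih =>
    simp only [bitMask, List.foldr_cons, Nat.testBit_or, Nat.one_shiftLeft, Nat.testBit_two_pow,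
      Bool.or_eq_true, decide_eq_true_eq] at h
    rcases h with h | rfl
    · exact List.mem_cons_of_mem _ (ih (by simpa only [bitMask, Nat.one_shiftLeft] using h))
    · exact List.mem_cons_self

/-- The second conjunct carries the induction: each entry must avoid the bits of all entries read
before it. -/
theorem nodup_of_distinctBits {l : List ℕ} {acc : ℕ} (h : distinctBits l acc = true) :
    l.Nodup ∧ ∀ c ∈ l, acc.testBit c = false := by
  induction l generalizing acc with
  | nil => simp
  | cons d l ih =>
    simp only [distinctBits, Bool.and_eq_true, Bool.not_eq_true'] at h
    obtain ⟨hl, hacc⟩ := ih h.2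
    simp only [Nat.testBit_or, Nat.one_shiftLeft, Nat.testBit_two_pow, Bool.or_eq_false_iff,
      decide_eq_false_iff_not] at hacc
    refine ⟨List.nodup_cons.2 ⟨fun hd => (hacc d hd).2 rfl, hl⟩, ?_⟩
    intro c hc
    rcases List.mem_cons.1 hc with rfl | hc
    · exact h.1
    · exact (hacc c hc).1

/-- The finite conditions on base blocks in the method of differences. -/
def IsBaseBlocks {m r : ℕ} [NeZero m] {F : Type} [DecidableEq F]
    (K : SimpleGraph (OrbitVertex m r F)) (f : ℕ → OrbitVertex m r F) (a b c : ℕ)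
    (B : List (List ℕ)) : Prop :=
  (∀ i < B.length, ((List.range (a + b + c - 1)).map (blockVertex f B i)).Nodup) ∧
  (∀ l ∈ blockArcs a b c B, l.2.1 < a + b + c - 1 ∧ l.2.2 < a + b + c - 1 ∧
    K.Adj (blockVertex f B l.1 l.2.1) (blockVertex f B l.1 l.2.2)) ∧
  distinctBits ((blockArcs a b c B).map (arcDiff f B)) 0 = true ∧
  -- Arcs leaving position 0 of each orbit suffice, because translation reaches all other positions.
  (∀ i y, K.Adj (.inl (0, i)) y →
    (bitMask ((blockArcs a b c B).map (arcDiff f B))).testBit (orbitCode (.inl (0, i)) y) = true) ∧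
  (∀ s y, K.Adj (.inr s) y →
    (bitMask ((blockArcs a b c B).map (arcDiff f B))).testBit (orbitCode (.inr s) y) = true)

instance {m r : ℕ} [NeZero m] {F : Type} [DecidableEq F] [Fintype F]
    (K : SimpleGraph (OrbitVertex m r F)) [DecidableRel K.Adj] (f : ℕ → OrbitVertex m r F)
    (a b c : ℕ) (B : List (List ℕ)) : Decidable (IsBaseBlocks K f a b c B) := by
  unfold IsBaseBlocks
  infer_instance

theorem orbitShift_injective {m r : ℕ} [NeZero m] {F : Type} (g : Fin m) :
    Function.Injective (orbitShift (r := r) (F := F) g) := by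
  rintro (⟨x, i⟩ | s) (⟨y, j⟩ | s') h <;> simp_all [orbitShift]

theorem orbitCode_shift {m r : ℕ} [NeZero m] {F : Type} (g : Fin m) (x y : OrbitVertex m r F) :
    orbitCode (orbitShift g x) (orbitShift g y) = orbitCode x y := by
  rcases x with ⟨x, i⟩ | s <;> rcases y with ⟨y, j⟩ | s' <;> simp [orbitShift, orbitCode]

/-- Two distinct vertices are not both fixed, as there is at most one fixed point. A vertex in a
full orbit then determines the translation, and equality of differences makes it fit the other
vertex too. -/
theorem existsUnique_orbitShift {m r : ℕ} [NeZero m] {F : Type} [Subsingleton F]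
    (x y x' y' : OrbitVertex m r F) (hxy : x ≠ y) (h : orbitCode x y = orbitCode x' y') :
    ∃! g, orbitShift g x = x' ∧ orbitShift g y = y' := by
  rcases x with ⟨x, i⟩ | s
  · rcases x' with ⟨x', i'⟩ | s'
    · refine ⟨x' - x, ?_, ?_⟩
      · rcases y with ⟨y, j⟩ | s <;> rcases y' with ⟨y', j'⟩ | s' <;>
          simp_all [orbitShift, orbitCode, Fin.val_inj]
        · rw [add_sub_left_comm, h.1]; abel
        · exact Subsingleton.elim _ _
      · rintro g ⟨hx, -⟩
        simp only [orbitShift, Sum.inl.injEq, Prod.mk.injEq] at hx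
        rw [← hx.1]; abel
    · rcases y with ⟨y, j⟩ | s <;> rcases y' with ⟨y', j'⟩ | s' <;> simp_all [orbitCode, Fin.val_inj]
  · rcases x' with ⟨x', i'⟩ | s'
    · rcases y with ⟨y, j⟩ | s <;> rcases y' with ⟨y', j'⟩ | s' <;> simp_all [orbitCode, Fin.val_inj]
    · rcases y with ⟨y, j⟩ | s''
      · rcases y' with ⟨y', j'⟩ | s'''
        · refine ⟨y' - y, ?_, ?_⟩
          · simp_all [orbitShift, orbitCode, Fin.val_inj]
            exact Subsingleton.elim _ _
          · rintro g ⟨-, hx⟩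
            simp only [orbitShift, Sum.inl.injEq, Prod.mk.injEq] at hx
            rw [← hx.1]; abel
        · simp_all [orbitCode]
      · exact absurd (congrArg _ (Subsingleton.elim _ _)) hxy

theorem IsBaseBlocks.isDecomposable {m r : ℕ} [NeZero m] {F : Type} [DecidableEq F]
    [Subsingleton F] {K : SimpleGraph (OrbitVertex m r F)}
    (hK : ∀ g x y, K.Adj x y → K.Adj (orbitShift g x) (orbitShift g y))
    {f : ℕ → OrbitVertex m r F} {a b c : ℕ} {B : List (List ℕ)}
    (h : IsBaseBlocks K f a b c B) : IsDecomposable K (thetaGraph a b c) := by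
  obtain ⟨h1, h2, h3, h4, h5⟩ := h
  replace h3 := (nodup_of_distinctBits h3).1
  have hmem : ∀ (i : Fin B.length) (u v : Fin (a + b + c - 1)), (thetaGraph a b c).Adj u v →
      ((i : ℕ), (u : ℕ), (v : ℕ)) ∈ blockArcs a b c B := by
    intro i u v huv
    exact List.mem_product.2 ⟨List.mem_range.2 i.2, ((thetaGraph_adj u v).1 huv).2⟩
  refine IsDecomposable.of_translates (ι := Fin B.length) orbitShift orbitCode
    orbitShift_injective hK orbitCode_shift
    (fun x y x' y' hxy _ he => existsUnique_orbitShift x y x' y' hxy.ne he)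
    (fun i u => blockVertex f B i u) ?_ ?_ ?_ ?_
  · intro i u v huv
    have := List.inj_on_of_nodup_map (h1 i i.2) (List.mem_range.2 u.2) (List.mem_range.2 v.2) huv
    exact Fin.ext this
  · exact fun i u v huv => (h2 _ (hmem i u v huv)).2.2
  · intro x y hxy
    have : orbitCode x y ∈ (blockArcs a b c B).map (arcDiff f B) := by
      rcases x with ⟨x, i⟩ | s
      -- Translate the first end to position 0, where coverage was checked.
      · have := h4 i (orbitShift (-x) y) (by simpa [orbitShift] using hK (-x) _ _ hxy)
        rw [← orbitCode_shift (-x)]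
        simpa [orbitShift] using mem_of_testBit_bitMask this
      · exact mem_of_testBit_bitMask (h5 s y hxy)
    obtain ⟨⟨i, u, v⟩, hl, he⟩ := List.mem_map.1 this
    obtain ⟨hu, hv, hadj⟩ := h2 _ hl
    obtain ⟨hi, huv⟩ := List.mem_product.1 hl
    refine ⟨⟨i, List.mem_range.1 hi⟩, ⟨u, hu⟩, ⟨v, hv⟩, (thetaGraph_adj _ _).2 ⟨?_, huv⟩, he⟩
    -- An arc `(u, u)` would be mapped to a loop of `K`.
    rintro heq
    obtain rfl : u = v := congrArg Fin.val heq
    exact hadj.ne rfl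
  · intro i u v i' u' v' huv huv' he
    have := List.inj_on_of_nodup_map h3 (hmem i u v huv) (hmem i' u' v' huv') he
    simp only [Prod.mk.injEq] at this
    exact ⟨Fin.ext this.1, Fin.ext this.2.1, Fin.ext this.2.2⟩

/-! ### The ingredients and their vertex labels -/

/-- The vertex with label `p`, without fixed points. -/
def orbitVertex (m r : ℕ) [NeZero m] [NeZero r] (p : ℕ) : OrbitVertex m r Empty :=
  .inl (Fin.ofNat m p, Fin.ofNat r (p / m))

/-- The vertex with label `p`, with one fixed point. -/
def orbitVertexFixed (m r : ℕ) [NeZero m] [NeZero r] (p : ℕ) : OrbitVertex m r Unit :=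
  if p < m * r then .inl (Fin.ofNat m p, Fin.ofNat r (p / m)) else .inr ()

/-- The complete multipartite graph whose parts are the orbits. -/
abbrev orbitPartite (m r : ℕ) : SimpleGraph (OrbitVertex m r Empty) :=
  (⊤ : SimpleGraph (Option (Fin r))).comap orbitLevel

/-- The complete multipartite graph with `k` parts of `w` vertices. -/
abbrev equipartite (w k : ℕ) : SimpleGraph (Fin w × Fin k) :=
  (⊤ : SimpleGraph (Fin k)).comap Prod.snd

theorem orbitLevel_shift {m r : ℕ} {F : Type} (g : Fin m) (x : OrbitVertex m r F) :
    orbitLevel (orbitShift g x) = orbitLevel x := by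
  cases x <;> rfl

theorem IsBaseBlocks.complete {m r : ℕ} [NeZero m] {F : Type} [DecidableEq F] [Fintype F]
    [Subsingleton F] {f : ℕ → OrbitVertex m r F} {a b c : ℕ} {B : List (List ℕ)}
    (h : IsBaseBlocks ⊤ f a b c B) {n : ℕ} (hn : m * r + Fintype.card F = n) :
    IsDecomposable (⊤ : SimpleGraph (Fin n)) (thetaGraph a b c) :=
  (h.isDecomposable fun g _ _ hxy => (orbitShift_injective g).ne hxy.ne).of_iso
    (SimpleGraph.Iso.completeGraph (Fintype.equivOfCardEq (by simp [hn])))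

theorem IsBaseBlocks.equipartite {m r : ℕ} [NeZero m] {f : ℕ → OrbitVertex m r Empty}
    {a b c : ℕ} {B : List (List ℕ)} (h : IsBaseBlocks (orbitPartite m r) f a b c B) :
    IsDecomposable (equipartite m r) (thetaGraph a b c) := by
  refine (h.isDecomposable fun g x y hxy => ?_).of_iso ⟨Equiv.sumEmpty _ _, ?_⟩
  · simpa [orbitLevel_shift] using hxy
  · rintro (x | x) (y | y) <;> first | exact x.elim | exact y.elim | simp [orbitLevel]

/-- The decompositions from which all others are composed. -/
structure HasIngredients {W : Type} (G : SimpleGraph W) : Prop where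
  complete : ∀ n ∈ [13, 14, 26, 27], IsDecomposable (⊤ : SimpleGraph (Fin n)) G
  multipartite : ∀ k ∈ [3, 4, 5], IsDecomposable (equipartite 13 k) G

theorem HasIngredients.of_baseBlocks {a b c : ℕ} (B13 B14 B26 B27 B39 B52 B65 : List (List ℕ))
    (h13 : IsBaseBlocks ⊤ (orbitVertexFixed 3 4) a b c B13)
    (h14 : IsBaseBlocks ⊤ (orbitVertex 7 2) a b c B14)
    (h26 : IsBaseBlocks ⊤ (orbitVertexFixed 5 5) a b c B26)
    (h27 : IsBaseBlocks ⊤ (orbitVertex 27 1) a b c B27)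
    (h39 : IsBaseBlocks (orbitPartite 13 3) (orbitVertex 13 3) a b c B39)
    (h52 : IsBaseBlocks (orbitPartite 13 4) (orbitVertex 13 4) a b c B52)
    (h65 : IsBaseBlocks (orbitPartite 13 5) (orbitVertex 13 5) a b c B65) :
    HasIngredients (thetaGraph a b c) := by
  constructor
  · simp only [List.forall_mem_cons]
    exact ⟨h13.complete rfl, h14.complete rfl, h26.complete rfl, h27.complete rfl, by simp⟩
  · simp only [List.forall_mem_cons]
    exact ⟨h39.equipartite, h52.equipartite, h65.equipartite, by simp⟩

/-! ### Base blocks for the thirteen theta graphs -/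

/-- Entry `u` of a list is the label of the image of theta vertex `u`; label `p` means position `p %
m` in orbit `p / m`, and the labels 12 and 25 are the fixed points in orders 13 and 26. The numbers
of base blocks are forced by counting edges: 2, 1, 5, 1 for the complete graphs and 3, 6, 10 for the
equipartite ones. -/
theorem hasIngredients_theta_1_2_10 : HasIngredients (thetaGraph 1 2 10) :=
  .of_baseBlocks
    [[9, 0, 12, 7, 6, 1, 8, 4, 11, 3, 5, 2], [0, 10, 11, 4, 2, 8, 5, 7, 12, 3, 9, 6]]
    [[11, 5, 1, 7, 2, 3, 10, 12, 4, 8, 9, 0]]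
    [[6, 18, 24, 8, 12, 9, 0, 4, 2, 15, 1, 22], [25, 18, 12, 7, 14, 4, 22, 23, 11, 15, 19, 8], [4,
      5, 10, 21, 13, 14, 20, 18, 1, 25, 23, 9], [19, 5, 22, 11, 21, 16, 0, 13, 1, 6, 3, 18], [22,
      13, 7, 24, 8, 1, 21, 2, 11, 18, 15, 10]]
    [[6, 14, 8, 2, 9, 18, 5, 4, 16, 13, 3, 19]]
    -- The equipartite lists have a further symmetry: adding 13 modulo 39 or 65 rotates the orbits
    -- and permutes the base blocks for 3 or 5 parts. For 4 parts the first three orbits rotate and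
    -- the labels from 39 on stay put.
    [[9, 23, 30, 36, 25, 3, 34, 18, 31, 11, 15, 38], [22, 36, 4, 10, 38, 16, 8, 31, 5, 24, 28,
      12], [35, 10, 17, 23, 12, 29, 21, 5, 18, 37, 2, 25]]
    [[45, 28, 3, 14, 10, 16, 5, 34, 7, 26, 46, 19], [38, 1, 48, 49, 37, 19, 6, 45, 26, 3, 44, 22],
      [45, 2, 16, 27, 23, 29, 18, 8, 20, 0, 46, 32], [12, 14, 48, 49, 11, 32, 19, 45, 0, 16, 44,
      35], [45, 15, 29, 1, 36, 3, 31, 21, 33, 13, 46, 6], [25, 27, 48, 49, 24, 6, 32, 45, 13, 29,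
      44, 9]]
    [[20, 10, 37, 31, 57, 21, 28, 41, 38, 46, 27, 39], [7, 57, 37, 38, 1, 29, 54, 35, 40, 18, 27,
      13], [33, 23, 50, 44, 5, 34, 41, 54, 51, 59, 40, 52], [20, 5, 50, 51, 14, 42, 2, 48, 53, 31,
      40, 26], [46, 36, 63, 57, 18, 47, 54, 2, 64, 7, 53, 0], [33, 18, 63, 64, 27, 55, 15, 61, 1,
      44, 53, 39], [59, 49, 11, 5, 31, 60, 2, 15, 12, 20, 1, 13], [46, 31, 11, 12, 40, 3, 28, 9,
      14, 57, 1, 52], [7, 62, 24, 18, 44, 8, 15, 28, 25, 33, 14, 26], [59, 44, 24, 25, 53, 16, 41,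
      22, 27, 5, 14, 0]]
    (by decide +kernel) (by decide +kernel) (by decide +kernel) (by decide +kernel)
    (by decide +kernel) (by decide +kernel) (by decide +kernel)

theorem hasIngredients_theta_1_3_9 : HasIngredients (thetaGraph 1 3 9) :=
  .of_baseBlocks
    [[8, 10, 0, 9, 2, 5, 6, 12, 1, 11, 3, 4], [7, 10, 4, 6, 8, 1, 0, 5, 9, 12, 3, 2]]
    [[0, 8, 12, 6, 5, 1, 11, 7, 9, 10, 3, 4]]
    [[4, 12, 14, 23, 24, 3, 22, 5, 10, 7, 2, 25], [7, 25, 5, 24, 13, 17, 12, 8, 10, 18, 22, 19],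
      [10, 13, 20, 19, 11, 23, 21, 6, 7, 4, 0, 2], [15, 7, 13, 1, 6, 24, 23, 16, 18, 0, 17, 3],
      [6, 22, 16, 0, 17, 5, 3, 12, 20, 15, 19, 4]]
    [[16, 13, 18, 4, 20, 5, 25, 8, 19, 11, 17, 12]]
    [[37, 2, 10, 24, 3, 14, 34, 18, 5, 29, 23, 31], [11, 15, 23, 37, 16, 27, 8, 31, 18, 3, 36, 5],
      [24, 28, 36, 11, 29, 1, 21, 5, 31, 16, 10, 18]]
    [[36, 2, 25, 47, 20, 11, 18, 45, 32, 17, 4, 37], [39, 19, 5, 48, 3, 13, 1, 42, 24, 49, 25,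
      33], [10, 15, 38, 47, 33, 24, 31, 45, 6, 30, 17, 11], [39, 32, 18, 48, 16, 26, 14, 42, 37,
      49, 38, 7], [23, 28, 12, 47, 7, 37, 5, 45, 19, 4, 30, 24], [39, 6, 31, 48, 29, 0, 27, 42,
      11, 49, 12, 20]]
    [[10, 57, 13, 43, 44, 20, 28, 40, 4, 42, 32, 17], [61, 2, 33, 54, 44, 22, 11, 43, 52, 29, 55,
      48], [23, 5, 26, 56, 57, 33, 41, 53, 17, 55, 45, 30], [9, 15, 46, 2, 57, 35, 24, 56, 0, 42,
      3, 61], [36, 18, 39, 4, 5, 46, 54, 1, 30, 3, 58, 43], [22, 28, 59, 15, 5, 48, 37, 4, 13, 55,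
      16, 9], [49, 31, 52, 17, 18, 59, 2, 14, 43, 16, 6, 56], [35, 41, 7, 28, 18, 61, 50, 17, 26,
      3, 29, 22], [62, 44, 0, 30, 31, 7, 15, 27, 56, 29, 19, 4], [48, 54, 20, 41, 31, 9, 63, 30,
      39, 16, 42, 35]]
    (by decide +kernel) (by decide +kernel) (by decide +kernel) (by decide +kernel)
    (by decide +kernel) (by decide +kernel) (by decide +kernel)

theorem hasIngredients_theta_1_4_8 : HasIngredients (thetaGraph 1 4 8) :=
  .of_baseBlocks
    [[8, 7, 10, 12, 4, 2, 9, 3, 0, 1, 6, 5], [9, 10, 5, 3, 1, 4, 0, 7, 11, 8, 12, 2]]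
    [[5, 9, 13, 12, 6, 4, 2, 11, 8, 3, 0, 7]]
    [[11, 18, 0, 13, 24, 14, 5, 23, 16, 8, 17, 19], [9, 14, 16, 2, 0, 1, 7, 5, 6, 20, 22, 21],
      [16, 3, 0, 5, 20, 25, 6, 22, 18, 1, 13, 21], [24, 25, 16, 11, 12, 3, 23, 4, 14, 18, 7, 0],
      [19, 11, 24, 14, 8, 9, 21, 12, 5, 1, 2, 17]]
    [[20, 21, 24, 7, 15, 23, 16, 4, 26, 1, 17, 8]]
    [[19, 2, 32, 18, 26, 10, 20, 31, 12, 15, 9, 14], [32, 15, 6, 31, 0, 23, 33, 5, 25, 28, 22,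
      27], [6, 28, 19, 5, 13, 36, 7, 18, 38, 2, 35, 1]]
    [[2, 49, 44, 29, 11, 26, 39, 7, 17, 6, 18, 5], [4, 24, 34, 48, 28, 27, 44, 7, 21, 3, 36, 46],
      [15, 49, 44, 3, 24, 0, 39, 20, 30, 19, 31, 18], [17, 37, 8, 48, 2, 1, 44, 20, 34, 16, 10,
      46], [28, 49, 44, 16, 37, 13, 39, 33, 4, 32, 5, 31], [30, 11, 21, 48, 15, 14, 44, 33, 8, 29,
      23, 46]]
    [[53, 26, 29, 59, 43, 44, 18, 62, 8, 30, 15, 47], [29, 0, 54, 31, 13, 48, 3, 23, 57, 2, 16,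
      53], [1, 39, 42, 7, 56, 57, 31, 10, 21, 43, 28, 60], [42, 13, 2, 44, 26, 61, 16, 36, 5, 15,
      29, 1], [14, 52, 55, 20, 4, 5, 44, 23, 34, 56, 41, 8], [55, 26, 15, 57, 39, 9, 29, 49, 18,
      28, 42, 14], [27, 0, 3, 33, 17, 18, 57, 36, 47, 4, 54, 21], [3, 39, 28, 5, 52, 22, 42, 62,
      31, 41, 55, 27], [40, 13, 16, 46, 30, 31, 5, 49, 60, 17, 2, 34], [16, 52, 41, 18, 0, 35, 55,
      10, 44, 54, 3, 40]]
    (by decide +kernel) (by decide +kernel) (by decide +kernel) (by decide +kernel)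
    (by decide +kernel) (by decide +kernel) (by decide +kernel)

theorem hasIngredients_theta_1_5_7 : HasIngredients (thetaGraph 1 5 7) :=
  .of_baseBlocks
    [[0, 3, 2, 4, 11, 9, 6, 1, 10, 12, 7, 8], [2, 3, 9, 8, 1, 12, 10, 7, 4, 5, 6, 11]]
    [[10, 1, 9, 2, 12, 4, 5, 3, 7, 11, 13, 0]]
    [[9, 19, 0, 13, 22, 23, 15, 3, 4, 7, 11, 17], [25, 2, 24, 17, 10, 9, 15, 8, 23, 18, 14, 4],
      [21, 24, 9, 8, 3, 16, 7, 12, 23, 4, 13, 14], [18, 19, 4, 15, 12, 14, 3, 9, 17, 23, 7, 5],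
      [12, 20, 9, 11, 25, 7, 0, 21, 1, 24, 2, 13]]
    [[21, 17, 18, 16, 23, 7, 6, 5, 0, 13, 4, 25]]
    [[1, 28, 20, 37, 23, 7, 27, 17, 6, 14, 12, 19], [14, 2, 33, 11, 36, 20, 1, 30, 19, 27, 25,
      32], [27, 15, 7, 24, 10, 33, 14, 4, 32, 1, 38, 6]]
    [[7, 38, 35, 43, 28, 19, 45, 6, 21, 1, 26, 42], [24, 43, 47, 12, 26, 23, 28, 15, 5, 42, 11,
      16], [20, 12, 9, 43, 2, 32, 45, 19, 34, 14, 0, 42], [37, 43, 47, 25, 0, 36, 2, 28, 18, 42,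
      24, 29], [33, 25, 22, 43, 15, 6, 45, 32, 8, 27, 13, 42], [11, 43, 47, 38, 13, 10, 15, 2, 31,
      42, 37, 3]]
    [[5, 29, 50, 30, 7, 20, 55, 24, 10, 40, 25, 39], [56, 51, 23, 31, 62, 32, 45, 33, 50, 53, 37,
      12], [18, 42, 63, 43, 20, 33, 3, 37, 23, 53, 38, 52], [4, 64, 36, 44, 10, 45, 58, 46, 63, 1,
      50, 25], [31, 55, 11, 56, 33, 46, 16, 50, 36, 1, 51, 0], [17, 12, 49, 57, 23, 58, 6, 59, 11,
      14, 63, 38], [44, 3, 24, 4, 46, 59, 29, 63, 49, 14, 64, 13], [30, 25, 62, 5, 36, 6, 19, 7,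
      24, 27, 11, 51], [57, 16, 37, 17, 59, 7, 42, 11, 62, 27, 12, 26], [43, 38, 10, 18, 49, 19,
      32, 20, 37, 40, 24, 64]]
    (by decide +kernel) (by decide +kernel) (by decide +kernel) (by decide +kernel)
    (by decide +kernel) (by decide +kernel) (by decide +kernel)

theorem hasIngredients_theta_1_6_6 : HasIngredients (thetaGraph 1 6 6) :=
  .of_baseBlocks
    [[9, 2, 10, 6, 12, 3, 4, 7, 5, 11, 8, 0], [9, 1, 0, 6, 3, 7, 8, 4, 11, 12, 2, 5]]
    [[7, 4, 1, 13, 8, 6, 0, 10, 9, 5, 3, 11]]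
    [[10, 17, 24, 2, 13, 21, 0, 6, 20, 7, 14, 11], [24, 15, 23, 13, 4, 8, 7, 19, 21, 14, 20, 1],
      [8, 5, 1, 16, 18, 19, 11, 23, 21, 15, 10, 2], [5, 19, 25, 22, 6, 18, 8, 10, 14, 2, 3, 1],
      [1, 25, 24, 4, 9, 21, 18, 7, 10, 19, 3, 13]]
    [[14, 25, 26, 23, 3, 12, 17, 8, 7, 5, 1, 11]]
    [[8, 17, 24, 5, 34, 2, 28, 16, 31, 9, 30, 3], [21, 30, 37, 18, 8, 15, 2, 29, 5, 22, 4, 16],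
      [34, 4, 11, 31, 21, 28, 15, 3, 18, 35, 17, 29]]
    [[20, 26, 32, 43, 14, 42, 17, 3, 23, 46, 19, 1], [40, 32, 21, 31, 0, 28, 50, 7, 20, 5, 48, 9],
      [33, 0, 6, 43, 27, 42, 30, 16, 36, 46, 32, 14], [40, 6, 34, 5, 13, 2, 50, 20, 33, 18, 48,
      22], [7, 13, 19, 43, 1, 42, 4, 29, 10, 46, 6, 27], [40, 19, 8, 18, 26, 15, 50, 33, 7, 31,
      48, 35]]
    [[34, 43, 20, 8, 14, 46, 6, 41, 64, 12, 29, 2], [28, 7, 49, 31, 8, 57, 18, 12, 44, 61, 11,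
      41], [47, 56, 33, 21, 27, 59, 19, 54, 12, 25, 42, 15], [41, 20, 62, 44, 21, 5, 31, 25, 57,
      9, 24, 54], [60, 4, 46, 34, 40, 7, 32, 2, 25, 38, 55, 28], [54, 33, 10, 57, 34, 18, 44, 38,
      5, 22, 37, 2], [8, 17, 59, 47, 53, 20, 45, 15, 38, 51, 3, 41], [2, 46, 23, 5, 47, 31, 57,
      51, 18, 35, 50, 15], [21, 30, 7, 60, 1, 33, 58, 28, 51, 64, 16, 54], [15, 59, 36, 18, 60,
      44, 5, 64, 31, 48, 63, 28]]
    (by decide +kernel) (by decide +kernel) (by decide +kernel) (by decide +kernel)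
    (by decide +kernel) (by decide +kernel) (by decide +kernel)

theorem hasIngredients_theta_2_2_9 : HasIngredients (thetaGraph 2 2 9) :=
  .of_baseBlocks
    [[6, 7, 5, 10, 12, 4, 9, 2, 11, 0, 8, 1], [3, 5, 2, 9, 1, 0, 12, 11, 10, 8, 7, 4]]
    [[4, 7, 1, 3, 12, 2, 11, 13, 9, 10, 5, 0]]
    [[15, 3, 23, 10, 2, 18, 5, 25, 17, 6, 21, 4], [6, 18, 15, 4, 23, 12, 21, 22, 16, 1, 3, 14],
      [11, 25, 10, 24, 7, 9, 5, 2, 23, 19, 12, 4], [10, 11, 1, 9, 16, 15, 5, 21, 23, 13, 20, 6],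
      [19, 20, 7, 2, 11, 13, 5, 0, 9, 3, 22, 15]]
    [[21, 4, 8, 3, 19, 7, 23, 20, 13, 5, 15, 9]]
    [[9, 8, 16, 38, 35, 24, 12, 37, 3, 27, 7, 30], [22, 21, 29, 12, 9, 37, 25, 11, 16, 1, 20, 4],
      [35, 34, 3, 25, 22, 11, 38, 24, 29, 14, 33, 17]]
    [[28, 33, 14, 21, 18, 7, 25, 3, 40, 26, 49, 2], [5, 47, 22, 29, 48, 16, 42, 20, 49, 3, 19, 6],
      [2, 7, 27, 34, 31, 20, 38, 16, 40, 0, 49, 15], [18, 47, 35, 3, 48, 29, 42, 33, 49, 16, 32,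
      19], [15, 20, 1, 8, 5, 33, 12, 29, 40, 13, 49, 28], [31, 47, 9, 16, 48, 3, 42, 7, 49, 29, 6,
      32]]
    [[59, 38, 18, 22, 23, 33, 3, 21, 35, 47, 1, 64], [59, 55, 25, 11, 38, 0, 19, 42, 15, 2, 35,
      44], [7, 51, 31, 35, 36, 46, 16, 34, 48, 60, 14, 12], [7, 3, 38, 24, 51, 13, 32, 55, 28, 15,
      48, 57], [20, 64, 44, 48, 49, 59, 29, 47, 61, 8, 27, 25], [20, 16, 51, 37, 64, 26, 45, 3,
      41, 28, 61, 5], [33, 12, 57, 61, 62, 7, 42, 60, 9, 21, 40, 38], [33, 29, 64, 50, 12, 39, 58,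
      16, 54, 41, 9, 18], [46, 25, 5, 9, 10, 20, 55, 8, 22, 34, 53, 51], [46, 42, 12, 63, 25, 52,
      6, 29, 2, 54, 22, 31]]
    (by decide +kernel) (by decide +kernel) (by decide +kernel) (by decide +kernel)
    (by decide +kernel) (by decide +kernel) (by decide +kernel)

theorem hasIngredients_theta_2_3_8 : HasIngredients (thetaGraph 2 3 8) :=
  .of_baseBlocks
    [[1, 3, 8, 6, 10, 7, 9, 11, 0, 2, 12, 5], [1, 3, 11, 5, 0, 10, 12, 8, 4, 7, 6, 9]]
    [[8, 4, 7, 11, 9, 0, 6, 3, 5, 12, 1, 10]]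
    [[7, 20, 6, 19, 0, 13, 22, 17, 2, 5, 14, 10], [7, 9, 22, 16, 17, 24, 11, 18, 0, 13, 4, 3], [5,
      9, 12, 0, 2, 21, 22, 20, 18, 10, 13, 25], [25, 12, 18, 3, 24, 20, 2, 19, 16, 22, 11, 0],
      [16, 1, 5, 20, 17, 11, 6, 8, 18, 14, 4, 23]]
    [[25, 11, 4, 10, 21, 7, 20, 12, 16, 14, 9, 8]]
    [[27, 37, 17, 0, 24, 9, 18, 33, 16, 2, 20, 4], [1, 11, 30, 13, 37, 22, 31, 7, 29, 15, 33, 17],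
      [14, 24, 4, 26, 11, 35, 5, 20, 3, 28, 7, 30]]
    [[15, 51, 30, 6, 16, 31, 12, 32, 47, 22, 40, 11], [29, 11, 15, 39, 19, 46, 22, 4, 17, 49, 10,
      38], [28, 51, 4, 19, 29, 5, 25, 6, 47, 35, 40, 24], [3, 24, 28, 39, 32, 46, 35, 17, 30, 49,
      23, 12], [2, 51, 17, 32, 3, 18, 38, 19, 47, 9, 40, 37], [16, 37, 2, 39, 6, 46, 9, 30, 4, 49,
      36, 25]]
    [[17, 24, 50, 59, 46, 44, 33, 63, 32, 4, 64, 1], [7, 5, 58, 43, 62, 32, 11, 35, 19, 10, 55,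
      51], [30, 37, 63, 7, 59, 57, 46, 11, 45, 17, 12, 14], [20, 18, 6, 56, 10, 45, 24, 48, 32,
      23, 3, 64], [43, 50, 11, 20, 7, 5, 59, 24, 58, 30, 25, 27], [33, 31, 19, 4, 23, 58, 37, 61,
      45, 36, 16, 12], [56, 63, 24, 33, 20, 18, 7, 37, 6, 43, 38, 40], [46, 44, 32, 17, 36, 6, 50,
      9, 58, 49, 29, 25], [4, 11, 37, 46, 33, 31, 20, 50, 19, 56, 51, 53], [59, 57, 45, 30, 49,
      19, 63, 22, 6, 62, 42, 38]]
    (by decide +kernel) (by decide +kernel) (by decide +kernel) (by decide +kernel)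
    (by decide +kernel) (by decide +kernel) (by decide +kernel)

theorem hasIngredients_theta_2_4_7 : HasIngredients (thetaGraph 2 4 7) :=
  .of_baseBlocks
    [[11, 0, 6, 8, 7, 2, 5, 1, 10, 12, 4, 3], [9, 2, 10, 4, 8, 12, 5, 7, 11, 1, 3, 6]]
    [[10, 5, 2, 8, 1, 11, 13, 7, 3, 4, 9, 0]]
    [[13, 22, 3, 20, 18, 7, 0, 16, 25, 2, 4, 9], [22, 16, 4, 20, 17, 21, 5, 15, 8, 13, 9, 10],
      [17, 9, 8, 2, 5, 12, 23, 13, 18, 11, 15, 7], [2, 25, 24, 6, 22, 11, 9, 3, 4, 20, 21, 7],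
      [23, 16, 3, 10, 13, 2, 14, 0, 12, 11, 19, 18]]
    [[25, 17, 24, 14, 5, 7, 3, 18, 26, 22, 8, 11]]
    [[4, 13, 37, 26, 16, 28, 38, 2, 34, 9, 35, 5], [17, 26, 11, 0, 29, 2, 12, 15, 8, 22, 9, 18],
      [30, 0, 24, 13, 3, 15, 25, 28, 21, 35, 22, 31]]
    [[13, 45, 27, 10, 51, 26, 33, 0, 46, 12, 48, 31], [10, 16, 45, 36, 13, 1, 28, 17, 35, 5, 27,
      40], [26, 45, 1, 23, 51, 0, 7, 13, 46, 25, 48, 5], [23, 29, 45, 10, 26, 14, 2, 30, 9, 18, 1,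
      40], [0, 45, 14, 36, 51, 13, 20, 26, 46, 38, 48, 18], [36, 3, 45, 23, 0, 27, 15, 4, 22, 31,
      14, 40]]
    [[37, 53, 12, 23, 10, 32, 60, 28, 40, 8, 58, 50], [55, 17, 12, 14, 43, 36, 51, 4, 31, 5, 35,
      7], [50, 1, 25, 36, 23, 45, 8, 41, 53, 21, 6, 63], [3, 30, 25, 27, 56, 49, 64, 17, 44, 18,
      48, 20], [63, 14, 38, 49, 36, 58, 21, 54, 1, 34, 19, 11], [16, 43, 38, 40, 4, 62, 12, 30,
      57, 31, 61, 33], [11, 27, 51, 62, 49, 6, 34, 2, 14, 47, 32, 24], [29, 56, 51, 53, 17, 10,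
      25, 43, 5, 44, 9, 46], [24, 40, 64, 10, 62, 19, 47, 15, 27, 60, 45, 37], [42, 4, 64, 1, 30,
      23, 38, 56, 18, 57, 22, 59]]
    (by decide +kernel) (by decide +kernel) (by decide +kernel) (by decide +kernel)
    (by decide +kernel) (by decide +kernel) (by decide +kernel)

theorem hasIngredients_theta_2_5_6 : HasIngredients (thetaGraph 2 5 6) :=
  .of_baseBlocks
    [[0, 1, 7, 5, 10, 12, 2, 11, 6, 8, 3, 4], [10, 11, 4, 9, 2, 3, 7, 1, 6, 12, 5, 8]]
    [[12, 2, 6, 1, 10, 5, 3, 4, 7, 8, 11, 9]]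
    [[16, 23, 15, 8, 1, 17, 7, 4, 20, 18, 11, 12], [13, 1, 19, 21, 6, 11, 15, 20, 0, 2, 14, 24],
      [0, 3, 22, 5, 12, 25, 4, 10, 2, 8, 7, 18], [22, 6, 18, 23, 14, 8, 20, 17, 15, 10, 12, 9],
      [25, 22, 20, 18, 10, 1, 9, 5, 14, 3, 7, 16]]
    [[20, 23, 22, 14, 3, 21, 9, 16, 24, 2, 19, 26]]
    [[0, 27, 16, 35, 20, 34, 1, 21, 3, 13, 38, 8], [13, 1, 29, 9, 33, 8, 14, 34, 16, 26, 12, 21],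
      [26, 14, 3, 22, 7, 21, 27, 8, 29, 0, 25, 34]]
    [[42, 34, 24, 22, 50, 27, 3, 5, 32, 7, 26, 4], [45, 50, 24, 29, 46, 21, 2, 31, 13, 0, 16, 5],
      [42, 8, 37, 35, 50, 1, 16, 18, 6, 20, 0, 17], [45, 50, 37, 3, 46, 34, 15, 5, 26, 13, 29,
      18], [42, 21, 11, 9, 50, 14, 29, 31, 19, 33, 13, 30], [45, 50, 11, 16, 46, 8, 28, 18, 0, 26,
      3, 31]]
    [[54, 13, 3, 25, 36, 40, 34, 16, 9, 43, 23, 26], [58, 21, 46, 22, 55, 29, 51, 17, 54, 32, 50,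
      52], [2, 26, 16, 38, 49, 53, 47, 29, 22, 56, 36, 39], [6, 34, 59, 35, 3, 42, 64, 30, 2, 45,
      63, 0], [15, 39, 29, 51, 62, 1, 60, 42, 35, 4, 49, 52], [19, 47, 7, 48, 16, 55, 12, 43, 15,
      58, 11, 13], [28, 52, 42, 64, 10, 14, 8, 55, 48, 17, 62, 0], [32, 60, 20, 61, 29, 3, 25, 56,
      28, 6, 24, 26], [41, 0, 55, 12, 23, 27, 21, 3, 61, 30, 10, 13], [45, 8, 33, 9, 42, 16, 38,
      4, 41, 19, 37, 39]]
    (by decide +kernel) (by decide +kernel) (by decide +kernel) (by decide +kernel)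
    (by decide +kernel) (by decide +kernel) (by decide +kernel)

theorem hasIngredients_theta_3_3_7 : HasIngredients (thetaGraph 3 3 7) :=
  .of_baseBlocks
    [[10, 9, 1, 7, 4, 12, 6, 5, 3, 11, 0, 2], [6, 8, 2, 5, 1, 3, 7, 10, 11, 4, 0, 12]]
    [[6, 12, 2, 9, 1, 0, 10, 4, 13, 5, 8, 7]]
    [[13, 24, 2, 10, 3, 15, 9, 8, 1, 0, 5, 20], [22, 5, 2, 16, 17, 13, 8, 0, 23, 10, 9, 18], [22,
      25, 19, 16, 20, 14, 6, 9, 0, 12, 18, 2], [7, 15, 17, 2, 12, 10, 20, 8, 25, 23, 13, 16], [3,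
      6, 12, 13, 20, 18, 22, 10, 17, 23, 2, 0]]
    [[1, 2, 7, 15, 21, 11, 13, 24, 22, 19, 20, 25]]
    [[3, 14, 16, 32, 27, 0, 33, 13, 7, 24, 34, 6], [16, 27, 29, 6, 1, 13, 7, 26, 20, 37, 8, 19],
      [29, 1, 3, 19, 14, 26, 20, 0, 33, 11, 21, 32]]
    [[20, 35, 30, 15, 12, 43, 33, 42, 28, 51, 8, 50], [30, 42, 21, 4, 24, 10, 50, 0, 18, 2, 14,
      3], [33, 9, 4, 28, 25, 43, 7, 42, 2, 51, 21, 50], [4, 42, 34, 17, 37, 23, 50, 13, 31, 15,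
      27, 16], [7, 22, 17, 2, 38, 43, 20, 42, 15, 51, 34, 50], [17, 42, 8, 30, 11, 36, 50, 26, 5,
      28, 1, 29]]
    [[19, 57, 32, 1, 4, 22, 29, 43, 62, 9, 40, 25], [32, 38, 21, 64, 40, 2, 15, 47, 6, 13, 62,
      22], [32, 5, 45, 14, 17, 35, 42, 56, 10, 22, 53, 38], [45, 51, 34, 12, 53, 15, 28, 60, 19,
      26, 10, 35], [45, 18, 58, 27, 30, 48, 55, 4, 23, 35, 1, 51], [58, 64, 47, 25, 1, 28, 41, 8,
      32, 39, 23, 48], [58, 31, 6, 40, 43, 61, 3, 17, 36, 48, 14, 64], [6, 12, 60, 38, 14, 41, 54,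
      21, 45, 52, 36, 61], [6, 44, 19, 53, 56, 9, 16, 30, 49, 61, 27, 12], [19, 25, 8, 51, 27, 54,
      2, 34, 58, 0, 49, 9]]
    (by decide +kernel) (by decide +kernel) (by decide +kernel) (by decide +kernel)
    (by decide +kernel) (by decide +kernel) (by decide +kernel)

theorem hasIngredients_theta_3_4_6 : HasIngredients (thetaGraph 3 4 6) :=
  .of_baseBlocks
    [[11, 7, 1, 0, 12, 8, 5, 2, 4, 3, 9, 10], [9, 7, 5, 6, 8, 10, 2, 4, 0, 3, 12, 1]]
    [[13, 0, 9, 1, 11, 12, 5, 3, 8, 6, 10, 4]]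
    [[7, 2, 12, 23, 21, 4, 13, 9, 25, 1, 14, 8], [17, 18, 10, 14, 12, 24, 9, 11, 7, 0, 5, 23], [4,
      18, 0, 8, 19, 16, 20, 1, 15, 23, 13, 5], [14, 1, 11, 24, 2, 22, 20, 17, 18, 0, 16, 5], [24,
      25, 8, 15, 18, 1, 11, 23, 6, 5, 12, 21]]
    [[16, 11, 18, 22, 3, 4, 19, 25, 8, 2, 7, 14]]
    [[2, 18, 20, 5, 35, 19, 9, 37, 17, 29, 21, 7], [15, 31, 33, 18, 9, 32, 22, 11, 30, 3, 34, 20],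
      [28, 5, 7, 31, 22, 6, 35, 24, 4, 16, 8, 33]]
    [[13, 5, 3, 20, 0, 33, 46, 44, 36, 22, 11, 47], [37, 43, 3, 24, 1, 51, 13, 44, 4, 31, 12, 21],
      [26, 18, 16, 33, 13, 7, 46, 44, 10, 35, 24, 47], [11, 43, 16, 37, 14, 51, 26, 44, 17, 5, 25,
      34], [0, 31, 29, 7, 26, 20, 46, 44, 23, 9, 37, 47], [24, 43, 29, 11, 27, 51, 0, 44, 30, 18,
      38, 8]]
    [[29, 9, 56, 16, 10, 41, 24, 62, 33, 43, 4, 61], [38, 5, 20, 29, 21, 55, 27, 24, 36, 59, 10,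
      64], [42, 22, 4, 29, 23, 54, 37, 10, 46, 56, 17, 9], [51, 18, 33, 42, 34, 3, 40, 37, 49, 7,
      23, 12], [55, 35, 17, 42, 36, 2, 50, 23, 59, 4, 30, 22], [64, 31, 46, 55, 47, 16, 53, 50,
      62, 20, 36, 25], [3, 48, 30, 55, 49, 15, 63, 36, 7, 17, 43, 35], [12, 44, 59, 3, 60, 29, 1,
      63, 10, 33, 49, 38], [16, 61, 43, 3, 62, 28, 11, 49, 20, 30, 56, 48], [25, 57, 7, 16, 8, 42,
      14, 11, 23, 46, 62, 51]]
    (by decide +kernel) (by decide +kernel) (by decide +kernel) (by decide +kernel)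
    (by decide +kernel) (by decide +kernel) (by decide +kernel)

theorem hasIngredients_theta_3_5_5 : HasIngredients (thetaGraph 3 5 5) :=
  .of_baseBlocks
    [[10, 3, 1, 7, 5, 2, 4, 6, 11, 8, 0, 12], [3, 11, 9, 1, 4, 0, 2, 6, 10, 12, 8, 7]]
    [[2, 11, 5, 6, 4, 10, 12, 1, 9, 0, 8, 7]]
    [[15, 6, 13, 7, 17, 22, 23, 9, 10, 11, 2, 0], [3, 24, 20, 14, 17, 11, 23, 15, 16, 5, 12, 8],
      [9, 25, 21, 24, 17, 13, 1, 16, 12, 15, 8, 3], [7, 3, 25, 14, 20, 4, 22, 2, 17, 24, 18, 19],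
      [14, 0, 4, 8, 11, 20, 12, 7, 1, 18, 9, 24]]
    [[17, 21, 23, 19, 7, 20, 13, 12, 22, 10, 26, 2]]
    [[38, 36, 23, 4, 7, 35, 5, 18, 9, 32, 10, 22], [12, 10, 36, 17, 20, 9, 18, 31, 22, 6, 23, 35],
      [25, 23, 10, 30, 33, 22, 31, 5, 35, 19, 36, 9]]
    [[32, 39, 43, 10, 11, 30, 5, 34, 4, 44, 22, 35], [38, 31, 11, 43, 40, 4, 34, 15, 3, 18, 44,
      23], [6, 39, 43, 23, 24, 4, 18, 8, 17, 44, 35, 9], [12, 5, 24, 43, 40, 17, 8, 28, 16, 31,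
      44, 36], [19, 39, 43, 36, 37, 17, 31, 21, 30, 44, 9, 22], [25, 18, 37, 43, 40, 30, 21, 2,
      29, 5, 44, 10]]
    [[32, 55, 58, 0, 5, 16, 49, 7, 2, 21, 52, 12], [24, 54, 57, 32, 42, 37, 40, 26, 48, 12, 62,
      41], [45, 3, 6, 13, 18, 29, 62, 20, 15, 34, 0, 25], [37, 2, 5, 45, 55, 50, 53, 39, 61, 25,
      10, 54], [58, 16, 19, 26, 31, 42, 10, 33, 28, 47, 13, 38], [50, 15, 18, 58, 3, 63, 1, 52, 9,
      38, 23, 2], [6, 29, 32, 39, 44, 55, 23, 46, 41, 60, 26, 51], [63, 28, 31, 6, 16, 11, 14, 0,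
      22, 51, 36, 15], [19, 42, 45, 52, 57, 3, 36, 59, 54, 8, 39, 64], [11, 41, 44, 19, 29, 24,
      27, 13, 35, 64, 49, 28]]
    (by decide +kernel) (by decide +kernel) (by decide +kernel) (by decide +kernel)
    (by decide +kernel) (by decide +kernel) (by decide +kernel)

theorem hasIngredients_theta_4_4_5 : HasIngredients (thetaGraph 4 4 5) :=
  .of_baseBlocks
    [[8, 9, 7, 1, 5, 3, 4, 12, 10, 11, 0, 2], [9, 7, 3, 11, 2, 6, 5, 0, 8, 12, 1, 4]]
    [[7, 6, 2, 4, 0, 10, 1, 12, 9, 8, 5, 13]]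
    [[24, 19, 11, 13, 9, 15, 20, 4, 12, 6, 18, 17], [5, 7, 8, 19, 6, 0, 3, 16, 13, 1, 23, 4], [25,
      20, 23, 0, 17, 2, 18, 11, 14, 15, 1, 7], [22, 11, 5, 21, 1, 24, 18, 10, 7, 3, 2, 9], [1, 6,
      14, 24, 20, 10, 19, 25, 12, 23, 16, 11]]
    [[14, 6, 16, 8, 26, 2, 15, 12, 18, 13, 24, 23]]
    [[34, 17, 13, 1, 30, 20, 36, 6, 14, 12, 18, 0], [8, 30, 26, 14, 4, 33, 10, 19, 27, 25, 31,
      13], [21, 4, 0, 27, 17, 7, 23, 32, 1, 38, 5, 26]]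
    [[38, 30, 44, 33, 7, 15, 50, 23, 1, 47, 21, 9], [5, 40, 48, 30, 12, 41, 7, 37, 22, 33, 14,
      28], [12, 4, 44, 7, 20, 28, 50, 36, 14, 47, 34, 22], [18, 40, 48, 4, 25, 41, 20, 11, 35, 7,
      27, 2], [25, 17, 44, 20, 33, 2, 50, 10, 27, 47, 8, 35], [31, 40, 48, 17, 38, 41, 33, 24, 9,
      20, 1, 15]]
    [[21, 45, 41, 23, 37, 57, 20, 7, 54, 8, 34, 55], [2, 48, 26, 24, 8, 56, 14, 36, 60, 43, 0,
      18], [34, 58, 54, 36, 50, 5, 33, 20, 2, 21, 47, 3], [15, 61, 39, 37, 21, 4, 27, 49, 8, 56,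
      13, 31], [47, 6, 2, 49, 63, 18, 46, 33, 15, 34, 60, 16], [28, 9, 52, 50, 34, 17, 40, 62, 21,
      4, 26, 44], [60, 19, 15, 62, 11, 31, 59, 46, 28, 47, 8, 29], [41, 22, 0, 63, 47, 30, 53, 10,
      34, 17, 39, 57], [8, 32, 28, 10, 24, 44, 7, 59, 41, 60, 21, 42], [54, 35, 13, 11, 60, 43, 1,
      23, 47, 30, 52, 5]]
    (by decide +kernel) (by decide +kernel) (by decide +kernel) (by decide +kernel)
    (by decide +kernel) (by decide +kernel) (by decide +kernel)

/-! ### Wilson's construction -/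

theorem IsDecomposable.complete_congr {V V' W : Type} {G : SimpleGraph W}
    (h : IsDecomposable (⊤ : SimpleGraph V) G) (e : V ≃ V') :
    IsDecomposable (⊤ : SimpleGraph V') G :=
  h.of_iso (SimpleGraph.Iso.completeGraph e)

/-- Wilson's construction: give every point of a group divisible design weight `w`, put
decompositions of equipartite graphs on the blocks and designs on the groups, the latter with the
points of `F` added. -/
theorem IsDecomposable.complete_of_gdd {X I J F W : Type} {G : SimpleGraph W} [Subsingleton F]
    {w : ℕ} (g : X → I) (B : J → Finset X)
    (hB : ∀ x y, g x ≠ g y → ∃! j, x ∈ B j ∧ y ∈ B j)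
    (hBg : ∀ j, ∀ x ∈ B j, ∀ y ∈ B j, g x = g y → x = y)
    (hBG : ∀ j, IsDecomposable (equipartite w (B j).card) G)
    (hG : ∀ i, IsDecomposable (⊤ : SimpleGraph (Fin w × {x // g x = i} ⊕ F)) G) :
    IsDecomposable (⊤ : SimpleGraph (Fin w × X ⊕ F)) G := by
  let φ : ∀ i, Fin w × {x // g x = i} ⊕ F ↪ Fin w × X ⊕ F := fun i =>
    ((Function.Embedding.refl _).prodMap (.subtype _)).sumMap (.refl _)
  let ψ : ∀ j, Fin w × Fin (B j).card ↪ Fin w × X ⊕ F := fun j =>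
    ((Function.Embedding.refl _).prodMap
      ((B j).equivFin.symm.toEmbedding.trans (.subtype _))).trans .inl
  let L : I ⊕ J → SimpleGraph (Fin w × X ⊕ F) :=
    Sum.elim (fun i => (⊤ : SimpleGraph _).map (φ i)) (fun j => (equipartite w (B j).card).map (ψ j))
  have hφ : ∀ i x y, (L (.inl i)).Adj x y ↔
      x ≠ y ∧ (∀ p, x = .inl p → g p.2 = i) ∧ ∀ p, y = .inl p → g p.2 = i := by
    intro i x y
    simp only [L, Sum.elim_inl, SimpleGraph.map_adj, SimpleGraph.top_adj]
    constructor
    · rintro ⟨u, v, huv, rfl, rfl⟩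
      refine ⟨(φ i).injective.ne huv, ?_, ?_⟩
      · rcases u with ⟨p, x, hx⟩ | s
        · rintro _ ⟨⟩; exact hx
        · rintro _ ⟨⟩
      · rcases v with ⟨p, x, hx⟩ | s
        · rintro _ ⟨⟩; exact hx
        · rintro _ ⟨⟩
    · rintro ⟨hne, hx, hy⟩
      have key : ∀ z : Fin w × X ⊕ F, (∀ p, z = .inl p → g p.2 = i) → ∃ u, φ i u = z := by
        rintro (⟨p, x⟩ | s) hz
        · exact ⟨.inl (p, ⟨x, hz _ rfl⟩), rfl⟩
        · exact ⟨.inr s, rfl⟩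
      obtain ⟨u, rfl⟩ := key x hx
      obtain ⟨v, rfl⟩ := key y hy
      exact ⟨u, v, fun h => hne (congrArg _ h), rfl, rfl⟩
  have hψ : ∀ j x y, (L (.inr j)).Adj x y ↔
      ∃ p q, x = .inl p ∧ y = .inl q ∧ p.2 ≠ q.2 ∧ p.2 ∈ B j ∧ q.2 ∈ B j := by
    intro j x y
    simp only [L, Sum.elim_inr, SimpleGraph.map_adj, SimpleGraph.comap_adj, SimpleGraph.top_adj]
    constructor
    · rintro ⟨⟨p, k⟩, ⟨q, l⟩, huv, rfl, rfl⟩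
      refine ⟨_, _, rfl, rfl, ?_, ((B j).equivFin.symm k).2, ((B j).equivFin.symm l).2⟩
      exact fun h => huv ((B j).equivFin.symm.injective (Subtype.ext h))
    · rintro ⟨⟨p, x⟩, ⟨q, y⟩, rfl, rfl, hne, hx, hy⟩
      refine ⟨(p, (B j).equivFin ⟨x, hx⟩), (q, (B j).equivFin ⟨y, hy⟩), ?_, ?_, ?_⟩
      · exact fun h => hne (congrArg Subtype.val ((B j).equivFin.injective h))
      · simp [ψ]
      · simp [ψ]
  refine IsDecomposable.union (L := L) ?_ ?_ ?_
  · intro _ x y h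
    exact h.ne
  · intro x y hxy
    -- Pairs over different groups belong to one block and to no group. All other pairs, including
    -- copies of one point and pairs with the added point, belong to one group and to no block.
    by_cases hg : ∃ p q, x = .inl p ∧ y = .inl q ∧ g p.2 ≠ g q.2
    · obtain ⟨p, q, rfl, rfl, hpq⟩ := hg
      obtain ⟨j, hj, hu⟩ := hB _ _ hpq
      refine ⟨.inr j, (hψ j _ _).2 ⟨p, q, rfl, rfl, fun h => hpq (congrArg g h), hj⟩, ?_⟩
      rintro (i | j') h
      · obtain ⟨-, h1, h2⟩ := (hφ i _ _).1 h
        exact absurd ((h1 p rfl).trans (h2 q rfl).symm) hpq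
      · obtain ⟨_, _, ⟨⟩, ⟨⟩, -, h⟩ := (hψ j' _ _).1 h
        rw [hu j' h]
    · push Not at hg
      have hr : ∀ j, ¬ (L (.inr j)).Adj x y := by
        intro j h
        obtain ⟨p, q, rfl, rfl, hne, hp, hq⟩ := (hψ j _ _).1 h
        exact hne (hBg j _ hp _ hq (hg p q rfl rfl))
      have hex : ∃ i, (L (.inl i)).Adj x y ∧ ∃ p, (x = .inl p ∨ y = .inl p) ∧ g p.2 = i := by
        rcases x with p | s
        · refine ⟨g p.2, (hφ _ _ _).2 ⟨hxy, ?_, ?_⟩, p, .inl rfl, rfl⟩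
          · rintro _ ⟨⟩; rfl
          · rintro q rfl; exact (hg p q rfl rfl).symm
        · rcases y with q | s'
          · refine ⟨g q.2, (hφ _ _ _).2 ⟨hxy, ?_, ?_⟩, q, .inr rfl, rfl⟩
            · rintro _ ⟨⟩
            · rintro _ ⟨⟩; rfl
          -- Two added points would form a pair lying in every group; there is at most one.
          · exact absurd (congrArg _ (Subsingleton.elim s s')) hxy
      obtain ⟨i, hi, p, hp, hpi⟩ := hex
      refine ⟨.inl i, hi, ?_⟩
      rintro (i' | j) h
      · obtain ⟨-, h1, h2⟩ := (hφ i' _ _).1 h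
        rcases hp with hp | hp
        · rw [← hpi, h1 p hp]
        · rw [← hpi, h2 p hp]
      · exact absurd h (hr j)
  · rintro (i | j)
    · exact (hG i).map (φ i)
    · exact (hBG j).map (ψ j)

/-- The inductive step: `hg` makes every group a proper subset, so a group of size `s` has `s < t`
and the design of order `13 * s + f` is already there. -/
theorem HasIngredients.complete_of_gdd {W X I J : Type} {G : SimpleGraph W} (hG : HasIngredients G)
    [Fintype X] {f t : ℕ} (hf : f ≤ 1) (hX : Fintype.card X = t)
    (ih : ∀ s < t, IsDecomposable (⊤ : SimpleGraph (Fin (13 * s + f))) G)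
    (g : X → I) (B : J → Finset X) (hB : ∀ x y, g x ≠ g y → ∃! j, x ∈ B j ∧ y ∈ B j)
    (hBg : ∀ j, ∀ x ∈ B j, ∀ y ∈ B j, g x = g y → x = y)
    (hcard : ∀ j, (B j).card ∈ [3, 4, 5]) (hg : ∀ i, ∃ x, g x ≠ i) :
    IsDecomposable (⊤ : SimpleGraph (Fin (13 * t + f))) G := by
  classical
  have : Subsingleton (Fin f) := Fin.subsingleton_iff_le_one.2 hf
  refine (IsDecomposable.complete_of_gdd (F := Fin f) (w := 13) g B hB hBg
    (fun j => hG.multipartite _ (hcard j)) fun i => ?_).complete_congr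
    (Fintype.equivOfCardEq (by simp [hX]))
  obtain ⟨x, hx⟩ := hg i
  exact (ih (Fintype.card {x // g x = i}) (hX ▸ Fintype.card_subtype_lt hx)).complete_congr
    (Fintype.equivOfCardEq (by simp))

/-! ### Truncated transversal designs -/

section Transversal

/-- The points of a transversal design with three groups of size `m` and one group truncated to
size `h`. -/
abbrev TruncatedPoint (m h : ℕ) : Type := Fin 3 × ZMod m ⊕ Fin h

variable {m h : ℕ}

/-- The group of a point. -/
def TruncatedPoint.row : TruncatedPoint m h → Fin 4
  | .inl p => p.1.castSucc
  | .inr _ => Fin.last 3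

/-- The position of a point in its group. -/
def TruncatedPoint.pos : TruncatedPoint m h → ZMod m
  | .inl p => p.2
  | .inr k => ((k : ℕ) : ZMod m)

/-- The coefficients of the four linear forms `a`, `b`, `a + b` and `a + 2 * b`. -/
def transversalCoeff (m : ℕ) : Fin 4 → ZMod m × ZMod m :=
  ![(1, 0), (0, 1), (1, 1), (1, 2)]

/-- The position at which a block of the transversal design meets a group. -/
def transversalForm (i : Fin 4) (j : ZMod m × ZMod m) : ZMod m :=
  (transversalCoeff m i).1 * j.1 + (transversalCoeff m i).2 * j.2

/-- The blocks of the truncated transversal design. -/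
def truncatedBlock (h : ℕ) (j : ZMod m × ZMod m) : Finset (TruncatedPoint m h) :=
  (Finset.univ.map ⟨fun i : Fin 3 => (i, transversalForm i.castSucc j), fun _ _ e =>
    (Prod.mk.inj e).1⟩).disjSum
  (Finset.univ.filter fun k : Fin h => ((k : ℕ) : ZMod m) = transversalForm (Fin.last 3) j)

theorem mem_truncatedBlock (j : ZMod m × ZMod m) (x : TruncatedPoint m h) :
    x ∈ truncatedBlock h j ↔ transversalForm x.row j = x.pos := by
  rcases x with ⟨i, z⟩ | k
  · simp only [truncatedBlock, Finset.inl_mem_disjSum, Finset.mem_map, Finset.mem_univ, true_and,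
      TruncatedPoint.row, TruncatedPoint.pos]
    constructor
    · rintro ⟨a, e⟩
      obtain ⟨rfl, rfl⟩ := Prod.mk.inj e
      rfl
    · exact fun e => ⟨i, e ▸ rfl⟩
  · simp [truncatedBlock, TruncatedPoint.row, TruncatedPoint.pos, eq_comm]

theorem natCast_fin_injective (hm : h ≤ m) (k l : Fin h)
    (e : ((k : ℕ) : ZMod m) = ((l : ℕ) : ZMod m)) : k = l := by
  rw [ZMod.natCast_eq_natCast_iff'] at e
  rwa [Nat.mod_eq_of_lt (k.2.trans_le hm), Nat.mod_eq_of_lt (l.2.trans_le hm), Fin.val_inj] at e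

theorem TruncatedPoint.ext_row_pos (hm : h ≤ m) {x y : TruncatedPoint m h} (hr : x.row = y.row)
    (hp : x.pos = y.pos) : x = y := by
  rcases x with ⟨i, z⟩ | k <;> rcases y with ⟨i', z'⟩ | k'
  · simp_all [TruncatedPoint.row, TruncatedPoint.pos]
  · exact absurd hr (Fin.castSucc_lt_last i).ne
  · exact absurd hr (Fin.castSucc_lt_last i').ne'
  · rw [natCast_fin_injective hm k k' hp]

/-- A block meets each full group once and the truncated group at most once, so its size is 3 or 4;
5 is listed only to match the ingredients. -/
theorem card_truncatedBlock (hm : h ≤ m) (j : ZMod m × ZMod m) :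
    (truncatedBlock h j).card ∈ [3, 4, 5] := by
  have : (Finset.univ.filter fun k : Fin h =>
      ((k : ℕ) : ZMod m) = transversalForm (Fin.last 3) j).card ≤ 1 := by
    refine Finset.card_le_one.2 fun k hk l hl => natCast_fin_injective hm k l ?_
    rw [(Finset.mem_filter.1 hk).2, (Finset.mem_filter.1 hl).2]
  rw [truncatedBlock, Finset.card_disjSum, Finset.card_map, Finset.card_univ, Fintype.card_fin]
  simp only [List.mem_cons, List.not_mem_nil, or_false]
  omega

/-- Any two of the four forms have determinant ±1 or ±2, a unit modulo odd `m`. Hence points in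
different groups lie in exactly one common block. -/
theorem existsUnique_transversalForm (hm : Odd m) {i i' : Fin 4} (hi : i ≠ i') (z z' : ZMod m) :
    ∃! j, transversalForm i j = z ∧ transversalForm i' j = z' := by
  have hdet : ∃ e, e * ((transversalCoeff m i).1 * (transversalCoeff m i').2 -
      (transversalCoeff m i).2 * (transversalCoeff m i').1) = 1 := by
    obtain ⟨k, hk⟩ := hm
    -- With `m = 2k + 1`, the inverse of 2 is `-k`.
    have h2 : (k : ZMod m) * 2 = -1 := by
      have : ((2 * k + 1 : ℕ) : ZMod m) = 0 := by rw [← hk, ZMod.natCast_self]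
      push_cast at this
      linear_combination this
    fin_cases i <;> fin_cases i' <;> first
      | exact absurd rfl hi
      | (refine ⟨1, ?_⟩; simp [transversalCoeff]; done)
      | (refine ⟨-1, ?_⟩; simp [transversalCoeff]; done)
      | (refine ⟨k, ?_⟩; simp [transversalCoeff, h2]; done)
      | (refine ⟨-k, ?_⟩; simp [transversalCoeff, h2]; done)
      | (refine ⟨1, ?_⟩; norm_num [transversalCoeff]; done)
      | (refine ⟨-1, ?_⟩; norm_num [transversalCoeff])
  obtain ⟨e, he⟩ := hdet
  unfold transversalForm
  set p := (transversalCoeff m i).1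
  set q := (transversalCoeff m i).2
  set p' := (transversalCoeff m i').1
  set q' := (transversalCoeff m i').2
  -- Cramer's rule, with `e` the inverse of the determinant.
  refine ⟨(e * (q' * z - q * z'), e * (p * z' - p' * z)), ⟨?_, ?_⟩, ?_⟩
  · linear_combination z * he
  · linear_combination z' * he
  · rintro ⟨a, b⟩ ⟨h1, h2⟩
    simp only at h1 h2
    ext
    · simp only
      linear_combination (-a) * he + e * q' * h1 - e * q * h2
    · simp only
      linear_combination (-b) * he + e * p * h2 - e * p' * h1

theorem HasIngredients.complete_of_odd {W : Type} {G : SimpleGraph W} (hG : HasIngredients G)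
    {f m h : ℕ} (hf : f ≤ 1) (hm : Odd m) (hh : h ≤ m)
    (ih : ∀ s < 3 * m + h, IsDecomposable (⊤ : SimpleGraph (Fin (13 * s + f))) G) :
    IsDecomposable (⊤ : SimpleGraph (Fin (13 * (3 * m + h) + f))) G := by
  have : NeZero m := ⟨hm.pos.ne'⟩
  refine hG.complete_of_gdd (X := TruncatedPoint m h) hf (by simp [ZMod.card]) ih
    TruncatedPoint.row (truncatedBlock h) ?_ ?_ (card_truncatedBlock hh) ?_
  · intro x y hxy
    simp only [mem_truncatedBlock]
    exact existsUnique_transversalForm hm hxy _ _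
  · intro j x hx y hy hr
    rw [mem_truncatedBlock] at hx hy
    exact TruncatedPoint.ext_row_pos hh hr (by rw [← hx, ← hy, hr])
  · intro i
    by_cases hi : i = 0
    · exact ⟨.inl (1, 0), by rw [hi]; simp [TruncatedPoint.row]⟩
    · exact ⟨.inl (0, 0), fun e => hi (by rw [← e]; rfl)⟩

end Transversal

/-! ### The recursion on the number of points -/

/-- Take `m` to be `t / 3` or `t / 3 - 1`, whichever is odd. Then `h` is at most 2 or at most 5
respectively, and the listed values are those where `m` is too small. -/
theorem exists_odd_of_large {t : ℕ} (ht : t ∉ [0, 1, 2, 5, 6, 7, 8, 13, 14]) :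
    ∃ m h, Odd m ∧ h ≤ m ∧ t = 3 * m + h := by
  simp only [List.mem_cons, List.not_mem_nil, or_false, not_or] at ht
  rcases Nat.even_or_odd (t / 3) with he | ho
  · refine ⟨t / 3 - 1, t - 3 * (t / 3 - 1), ?_, ?_, ?_⟩
    · obtain ⟨k, hk⟩ := he
      exact ⟨k - 1, by omega⟩
    · obtain ⟨k, hk⟩ := he
      omega
    · omega
  · obtain ⟨k, hk⟩ := ho
    exact ⟨t / 3, t - 3 * (t / 3), ⟨k, hk⟩, by omega, by omega⟩

theorem HasIngredients.isDecomposable {W : Type} {G : SimpleGraph W} (hG : HasIngredients G)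
    {f : ℕ} (hf : f ≤ 1) (t : ℕ) : IsDecomposable (⊤ : SimpleGraph (Fin (13 * t + f))) G := by
  induction t using Nat.strong_induction_on with
  | _ t ih =>
    by_cases ht : t ∈ [0, 1, 2, 5, 6, 7, 8, 13, 14]
    · simp only [List.mem_cons, List.not_mem_nil, or_false] at ht
      rcases ht with rfl | rfl | rfl | rfl | rfl | rfl | rfl | rfl | rfl
      · have : Subsingleton (Fin (13 * 0 + f)) := Fin.subsingleton_iff_le_one.2 (by omega)
        exact ⟨∅, by simp, fun x y hxy => absurd (Subsingleton.elim x y) hxy⟩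
      · exact hG.complete _ (by interval_cases f <;> simp)
      · exact hG.complete _ (by interval_cases f <;> simp)
      -- `t = 5`: singleton groups and a single block of size 5.
      · exact hG.complete_of_gdd (X := Fin 5) (J := Unit) hf rfl ih id (fun _ => Finset.univ)
          (fun x y _ => ⟨(), by simp, by simp⟩) (by decide) (by simp) (by decide)
      -- `t = 6`: the transversal design of the Latin square of order 2.
      · refine hG.complete_of_gdd (X := Fin 2 × Fin 3) (J := Fin 2 × Fin 2) hf rfl ih Prod.snd
          (fun j => {(j.1, 0), (j.2, 1), (j.1 + j.2, 2)}) ?_ ?_ ?_ ?_ <;>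
          (try unfold ExistsUnique) <;> decide +kernel
      -- `t = 7`: the Fano plane, from the difference set {0, 1, 3}.
      · refine hG.complete_of_gdd (X := Fin 7) (J := Fin 7) hf rfl ih id
          (fun j => {j, j + 1, j + 3}) ?_ ?_ ?_ ?_ <;>
          (try unfold ExistsUnique) <;> decide +kernel
      -- `t = 8`: modulo 8 the set {0, 1, 3} misses only the difference 4, so the groups are the
      -- pairs `x`, `x + 4`.
      · refine hG.complete_of_gdd (X := Fin 8) (J := Fin 8) hf rfl ih (fun x => Fin.ofNat 4 x)
          (fun j => {j, j + 1, j + 3}) ?_ ?_ ?_ ?_ <;>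
          (try unfold ExistsUnique) <;> decide +kernel
      -- `t = 13`: the projective plane of order 3, from the difference set {0, 1, 3, 9}.
      · refine hG.complete_of_gdd (X := Fin 13) (J := Fin 13) hf rfl ih id
          (fun j => {j, j + 1, j + 3, j + 9}) ?_ ?_ ?_ ?_ <;>
          (try unfold ExistsUnique) <;> decide +kernel
      -- `t = 14`: four base blocks modulo 7 on two orbits. The only missing difference is the mixed
      -- difference 0, which gives seven groups of size 2.
      · refine hG.complete_of_gdd (X := Fin 7 × Fin 2) (J := Fin 7 × Fin 4) hf rfl ih Prod.fst
          (fun j => ![{(j.1, 0), (j.1 + 1, 0), (j.1 + 3, 0)}, {(j.1, 0), (j.1 + 2, 1), (j.1 + 3, 1)},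
            {(j.1, 0), (j.1 + 4, 1), (j.1 + 6, 1)}, {(j.1, 0), (j.1 + 1, 1), (j.1 + 5, 1)}] j.2)
          ?_ ?_ ?_ ?_ <;>
          (try unfold ExistsUnique) <;> decide +kernel
    · obtain ⟨m, h, hm, hh, rfl⟩ := exists_odd_of_large ht
      exact hG.complete_of_odd hf hm hh ih

/-! ### The list of theta graphs with 13 edges -/

theorem hasIngredients_theta {a b c : ℕ} (ha : 1 ≤ a) (hab : a ≤ b) (hbc : b ≤ c) (hb : 2 ≤ b)
    (habc : a + b + c = 13) : HasIngredients (thetaGraph a b c) := by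
  obtain rfl : c = 13 - a - b := by omega
  have ha4 : a ≤ 4 := by omega
  have hb6 : b ≤ 6 := by omega
  interval_cases a <;> interval_cases b <;> first
    | omega
    | exact hasIngredients_theta_1_2_10
    | exact hasIngredients_theta_1_3_9
    | exact hasIngredients_theta_1_4_8
    | exact hasIngredients_theta_1_5_7
    | exact hasIngredients_theta_1_6_6
    | exact hasIngredients_theta_2_2_9
    | exact hasIngredients_theta_2_3_8
    | exact hasIngredients_theta_2_4_7
    | exact hasIngredients_theta_2_5_6
    | exact hasIngredients_theta_3_3_7
    | exact hasIngredients_theta_3_4_6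
    | exact hasIngredients_theta_3_5_5
    | exact hasIngredients_theta_4_4_5

instance (a b c : ℕ) : DecidableRel (thetaGraph a b c).Adj := fun u v =>
  decidable_of_iff _ (thetaGraph_adj u v).symm

theorem card_theta_arcs {a b c : ℕ} (ha : 1 ≤ a) (hab : a ≤ b) (hbc : b ≤ c) (hb : 2 ≤ b)
    (habc : a + b + c = 13) :
    Fintype.card {p : Fin (a + b + c - 1) × Fin (a + b + c - 1) //
      (thetaGraph a b c).Adj p.1 p.2} = 26 := by
  obtain rfl : c = 13 - a - b := by omega
  have ha4 : a ≤ 4 := by omega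
  have hb6 : b ≤ 6 := by omega
  interval_cases a <;> interval_cases b <;> first
    | omega
    | decide +kernel

/-! ### Necessity by counting arcs, and the theorem -/

/-- The number of arcs of `G` divides the number of arcs of a graph that decomposes into `G`. -/
theorem HasDecomposition.card_dvd {V W : Type*} {K : SimpleGraph V} {G : SimpleGraph W}
    (h : HasDecomposition K G) :
    Nat.card {p : W × W // G.Adj p.1 p.2} ∣ Nat.card {p : V × V // K.Adj p.1 p.2} := by
  obtain ⟨D, hD, hK⟩ := h
  have φ : ∀ H : D, G ≃g H.1.coe := fun H => (hD H H.2).some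
  let F : D × {p : W × W // G.Adj p.1 p.2} → {p : V × V // K.Adj p.1 p.2} := fun x =>
    ⟨(φ x.1 x.2.1.1, φ x.1 x.2.1.2), x.1.1.adj_sub ((φ x.1).map_adj_iff.2 x.2.2)⟩
  have hF : Function.Bijective F := by
    constructor
    · rintro ⟨H, ⟨u, v⟩, huv⟩ ⟨H', ⟨u', v'⟩, huv'⟩ he
      have h1 : (φ H u : V) = φ H' u' := congrArg (fun x => x.1.1) he
      have h2 : (φ H v : V) = φ H' v' := congrArg (fun x => x.1.2) he
      have hH : H.1.Adj (φ H u) (φ H v) := (φ H).map_adj_iff.2 huv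
      have hH' : H'.1.Adj (φ H u) (φ H v) := by
        rw [h1, h2]
        exact (φ H').map_adj_iff.2 huv'
      obtain rfl : H = H' := Subtype.ext
        -- Two copies sharing an arc coincide, since each edge lies in only one of them.
        ((hK s(_, _) (H.1.adj_sub hH)).unique ⟨H.2, hH⟩ ⟨H'.2, hH'⟩)
      obtain rfl : u = u' := (φ H).injective (Subtype.ext h1)
      obtain rfl : v = v' := (φ H).injective (Subtype.ext h2)
      rfl
    · rintro ⟨⟨x, y⟩, hxy⟩
      obtain ⟨H, ⟨hH, hadj⟩, -⟩ := hK s(x, y) hxy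
      rw [SimpleGraph.Subgraph.mem_edgeSet] at hadj
      refine ⟨(⟨H, hH⟩, ⟨((φ ⟨H, hH⟩).symm ⟨x, hadj.fst_mem⟩,
        (φ ⟨H, hH⟩).symm ⟨y, hadj.snd_mem⟩), ?_⟩), ?_⟩
      · exact (φ ⟨H, hH⟩).symm.map_adj_iff.2 hadj
      · simp [F]
  rw [← Nat.card_eq_of_bijective F hF, Nat.card_prod]
  exact Dvd.intro_left _ rfl

theorem card_complete_arcs (n : ℕ) :
    Nat.card {p : Fin n × Fin n // (⊤ : SimpleGraph (Fin n)).Adj p.1 p.2} = n * (n - 1) := by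
  classical
  rw [Nat.card_eq_fintype_card, Fintype.card_subtype]
  have : (Finset.univ.filter fun p : Fin n × Fin n => (⊤ : SimpleGraph (Fin n)).Adj p.1 p.2) =
      (Finset.univ : Finset (Fin n)).offDiag := by
    ext p
    simp
  rw [this, Finset.offDiag_card, Finset.card_univ, Fintype.card_fin, Nat.mul_sub_one]

theorem mainTheorem4 (a b c : ℕ) (ha : 1 ≤ a) (hab : a ≤ b) (hbc : b ≤ c) (hb : 2 ≤ b)
    (habc : a + b + c = 13) (n : ℕ) :
    HasDesign (thetaGraph a b c) n ↔ n ≡ 0 [MOD 13] ∨ n ≡ 1 [MOD 13] := by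
  have hG := hasIngredients_theta ha hab hbc hb habc
  constructor
  · intro h
    have hdvd := h.card_dvd
    rw [card_complete_arcs, Nat.card_eq_fintype_card, card_theta_arcs ha hab hbc hb habc] at hdvd
    have h13 : 13 ∣ n * (n - 1) := (by norm_num : 13 ∣ 26).trans hdvd
    rcases (by norm_num : Nat.Prime 13).dvd_mul.1 h13 with h | h
    · exact .inl ((Nat.modEq_zero_iff_dvd).2 h)
    -- For `n = 0` the truncated `n - 1` is 0, so this case needs the other residue.
    · rcases n with - | n
      · exact .inl rfl
      · right
        simp only [Nat.ModEq]
        omega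
  · rintro (h | h)
    · obtain ⟨t, rfl⟩ := (Nat.modEq_zero_iff_dvd).1 h
      exact (hG.isDecomposable (f := 0) zero_le_one t).hasDecomposition
    · have : n = 13 * (n / 13) + 1 := by
        have : n % 13 = 1 := h
        omega
      rw [this]
      exact (hG.isDecomposable le_rfl _).hasDecomposition
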